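/- Let $q,c\in\mathbb{C}$ with $q\neq 0$ and $|q|\neq 1$, and let $$\mathcal{D}_{q,c}g(z)=\frac{g(qz+c)-g(z)}{(q-1)z+c},\qquad \mathcal{D}_{q,c}^{0}g=g,\qquad \mathcal{D}_{q,c}^{j}g=\mathcal{D}_{q,c}\bigl(\mathcal{D}_{q,c}^{j-1}g\bigr)\quad(j\geq 1)$$ be the Hahn difference operator and its iterates. For a meromorphic function $g$ on $\mathbb{C}$ with Nevanlinna characteristic $T(r,g)$, let $$\rho_{\log}(g)=\limsup_{r\to\infty}\frac{\log^{+}T(r,g)}{\log\log r}\in[0,\infty]$$ be its logarithmic order. Let $k\geq 1$ and let $A_0,A_1,\dots,A_{k-1}$ be entire functions such that $\rho_{\log}(A_0)>\rho_{\log}(A_j)\geq 1$ for $j=1,\dots,k-1$. Suppose that $g$ is a non-constant entire solution of the linear Hahn difference equation $$\mathcal{D}_{q,c}^{k}g(z)+A_{k-1}(z)\mathcal{D}_{q,c}^{k-1}g(z)+\cdots+A_1(z)\mathcal{D}_{q,c}g(z)+A_0(z)g(z)=0$$ (for all $z$ with $(q-1)z+c\neq 0$). Then $\rho_{\log}(g)\geq\rho_{\log}(A_0)+1$.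 -/

import Mathlib

/-- The Hahn difference operator `(D_{q,c} g)(z) = (g(qz+c) - g(z)) / ((q-1)z + c)`.
At the fixed point of `z ↦ qz + c`, i.e. where `(q-1)z + c = 0`, the quotient is formally `0/0`
and the value given here carries no meaning. That point is reached from no other one
(`(q-1)(qz+c) + c = q((q-1)z + c)`), so for `q ≠ 0` iterates of the operator at any other point do
not depend on the value at the fixed point. -/
noncomputable def hahnDiff (q c : ℂ) (g : ℂ → ℂ) : ℂ → ℂ :=
  fun z => (g (q * z + c) - g z) / ((q - 1) * z + c)

/-- The logarithmic order `limsup_{r → ∞} log⁺ T(r, g) / log log r`, with values in `[-∞, ∞]`,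
where `T(r, g) = m(r, g) + N(r, g)` is the Nevanlinna characteristic (for the poles of `g`). -/
noncomputable def logOrder (g : ℂ → ℂ) : EReal :=
  Filter.limsup
    (fun r : ℝ =>
      ((Real.posLog (ValueDistribution.characteristic g ⊤ r) / Real.log (Real.log r) : ℝ) : EReal))
    Filter.atTop

open Real Metric Filter Topology

/-! If the conclusion fails, some β < ρ_log(A₀) exceeds 0, ρ_log(g) - 1 and every ρ_log(A_j), j ≥ 1,
so T(r,g) ≤ (log r)^(β+1) eventually. A Jensen-type count between radii r² and r⁴ then gives g only
n = O((log r)^β) zeros a_i in a disc of radius r²: one power of log r is gained. On |z| = r the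
zero-free cofactor is constant up to a bounded factor by Borel–Carathéodory, so for |w| ≤ Kr,
|g(w)/g(z)| is at most exp(B(z) + 1) with B(z) = ∑ log(K(r+|a_i|)/|z-a_i|)
(`eventually_exists_norm_le_exp_mul_norm`). The points of the affine orbit of z up to step k satisfy
|w| ≤ Kr. Dividing the equation by g(z) bounds |A₀(z)| by 2^k exp(B(z)+1)(1 + ∑|A_j(z)|). Each term
of B has circle average at most log(2K), hence T(r,A₀) ≤ ∑ T(r,A_j) + O((log r)^β)
(`eventually_characteristic_coeff_le`), which contradicts β < ρ_log(A₀). -/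

/-! ### Circle averages and the characteristic of entire functions. -/

/-- The exceptional set `S` will consist of zeros, where pointwise logarithmic bounds break down;
its preimage in the angle variable is countable, hence null. -/
theorem circleAverage_mono_of_countable {f₁ f₂ : ℂ → ℝ} {c : ℂ} {R : ℝ} {S : Set ℂ}
    (hR : R ≠ 0) (hS : S.Countable) (hf₁ : CircleIntegrable f₁ c R) (hf₂ : CircleIntegrable f₂ c R)
    (h : ∀ z ∈ sphere c |R|, z ∉ S → f₁ z ≤ f₂ z) :
    circleAverage f₁ c R ≤ circleAverage f₂ c R := by
  unfold circleAverage
  refine smul_le_smul_of_nonneg_left ?_ (by positivity)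
  refine intervalIntegral.integral_mono_ae (by positivity) hf₁ hf₂ ?_
  have := (hS.preimage_circleMap c hR).measure_zero MeasureTheory.volume
  filter_upwards [MeasureTheory.measure_eq_zero_iff_ae_notMem.mp this] with θ hθ
  exact h _ (circleMap_mem_sphere' c R θ) hθ

theorem Differentiable.characteristic_top_eq {f : ℂ → ℂ} (hf : Differentiable ℂ f) (r : ℝ) :
    ValueDistribution.characteristic f ⊤ r = circleAverage (fun z => log⁺ ‖f z‖) 0 r := by
  have hd : (MeromorphicOn.divisor f Set.univ)⁻ = 0 := by
    rw [negPart_eq_zero]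
    exact MeromorphicOn.AnalyticOnNhd.divisor_nonneg (fun z _ => hf.analyticAt z)
  simp [ValueDistribution.characteristic, ValueDistribution.logCounting_top,
    ValueDistribution.proximity_top, hd]

theorem Differentiable.circleIntegrable_posLog {f : ℂ → ℂ} (hf : Differentiable ℂ f) (c : ℂ)
    (r : ℝ) : CircleIntegrable (fun z => log⁺ ‖f z‖) c r :=
  ContinuousOn.circleIntegrable' (by have := hf.continuous; fun_prop)

theorem circleIntegrable_log_norm_sub (a c : ℂ) (r : ℝ) :
    CircleIntegrable (fun z => log ‖z - a‖) c r :=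
  MeromorphicOn.circleIntegrable_log_norm
    (analyticOnNhd_id.sub analyticOnNhd_const).meromorphicOn

/-! ### Zeros in a disc and the zero-free cofactor. -/

/-- A product of linear factors with `n` zeros in a small ball times `G`, bounded by `M` on a large
sphere: estimate of `G` on the large ball. -/
theorem norm_cofactor_le {G : ℂ → ℂ} (hG : Differentiable ℂ G) {x : ℂ} {R S M : ℝ}
    (hR : 0 < R) (hRS : R < S) {n : ℕ} {a : ℕ → ℂ} (ha : ∀ i < n, a i ∈ closedBall x R)
    (hM : ∀ z ∈ sphere x S, ‖(∏ i ∈ Finset.range n, (z - a i)) * G z‖ ≤ M)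
    {z : ℂ} (hz : z ∈ closedBall x S) : ‖G z‖ ≤ M / (S - R) ^ n := by
  have hSR : 0 < S - R := by linarith
  refine Complex.norm_le_of_forall_mem_frontier_norm_le (U := ball x S) isBounded_ball
    hG.diffContOnCl (fun w hw => ?_) (by rwa [closure_ball x (by linarith)])
  rw [frontier_ball x (by linarith)] at hw
  rw [le_div_iff₀ (by positivity), mul_comm]
  refine le_trans ?_ (hM w hw)
  rw [norm_mul, norm_prod]
  gcongr
  rw [← Finset.card_range n, ← Finset.prod_const, Finset.card_range]
  refine Finset.prod_le_prod (fun _ _ => hSR.le) fun i hi => ?_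
  have h1 := ha i (Finset.mem_range.1 hi)
  rw [mem_closedBall, dist_eq_norm] at h1
  rw [mem_sphere, dist_eq_norm] at hw
  have := norm_sub_norm_le (w - x) (a i - x)
  rw [sub_sub_sub_cancel_right] at this
  linarith

theorem norm_prod_sub_le {x : ℂ} {R : ℝ} {n : ℕ} {a : ℕ → ℂ}
    (ha : ∀ i < n, a i ∈ closedBall x R) : ‖∏ i ∈ Finset.range n, (x - a i)‖ ≤ R ^ n := by
  rw [norm_prod, ← Finset.card_range n, ← Finset.prod_const, Finset.card_range]
  refine Finset.prod_le_prod (fun _ _ => norm_nonneg _) fun i hi => ?_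
  simpa [dist_eq_norm, norm_sub_rev] using ha i (Finset.mem_range.1 hi)

/-- Each linear factor is at most `R` at the centre and at least `S - R` on the large sphere. With
`z = x` this is a Jensen-type bound on the number of zeros; for other `z` it bounds the growth of
the cofactor. -/
theorem log_cofactor_le {G : ℂ → ℂ} (hG : Differentiable ℂ G) {x : ℂ} {R S M : ℝ}
    (hR : 0 < R) (hRS : R < S) {n : ℕ} {a : ℕ → ℂ} (ha : ∀ i < n, a i ∈ closedBall x R)
    (hM : ∀ z ∈ sphere x S, ‖(∏ i ∈ Finset.range n, (z - a i)) * G z‖ ≤ M)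
    (hx : (∏ i ∈ Finset.range n, (x - a i)) * G x ≠ 0)
    {z : ℂ} (hz : z ∈ closedBall x S) (hGz : G z ≠ 0) :
    log ‖G z‖ - log ‖G x‖ + n * log ((S - R) / R) ≤
      log M - log ‖(∏ i ∈ Finset.range n, (x - a i)) * G x‖ := by
  have hSR : 0 < S - R := by linarith
  have h1 := norm_cofactor_le hG hR hRS ha hM hz
  have hMp : 0 < M := by
    by_contra hcon
    have : M / (S - R) ^ n ≤ 0 := div_nonpos_of_nonpos_of_nonneg (by linarith) (by positivity)
    have := norm_pos_iff.2 hGz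
    linarith
  have h2 := Real.log_le_log (norm_pos_iff.2 hGz) h1
  rw [Real.log_div hMp.ne' (by positivity), Real.log_pow] at h2
  have hx1 := left_ne_zero_of_mul hx
  have hx2 := right_ne_zero_of_mul hx
  have h3 := Real.log_le_log (norm_pos_iff.2 hx1) (norm_prod_sub_le ha)
  rw [Real.log_pow] at h3
  rw [norm_mul, Real.log_mul (norm_ne_zero_iff.2 hx1) (norm_ne_zero_iff.2 hx2), Real.log_div hSR.ne' hR.ne']
  linarith

/-- Splitting off all the zeros of an entire function in a closed ball. -/
theorem exists_eq_prod_mul_of_differentiable {g : ℂ → ℂ} (hg : Differentiable ℂ g) {x : ℂ}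
    (hx : g x ≠ 0) {R : ℝ} (hR : 0 < R) :
    ∃ (n : ℕ) (a : ℕ → ℂ) (G : ℂ → ℂ), (∀ i < n, a i ∈ closedBall x R) ∧ Differentiable ℂ G ∧
      (∀ z, g z = (∏ i ∈ Finset.range n, (z - a i)) * G z) ∧ ∀ z ∈ closedBall x R, G z ≠ 0 := by
  by_contra! hcon
  -- If every cofactor still vanished somewhere in the ball, arbitrarily many zeros could be split
  -- off, against the count with `S = 3 * R`, which gives n log 2 ≤ log M - log |g(x)|.
  have key : ∀ n : ℕ, ∃ (a : ℕ → ℂ) (G : ℂ → ℂ), (∀ i < n, a i ∈ closedBall x R) ∧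
      Differentiable ℂ G ∧ (∀ z, g z = (∏ i ∈ Finset.range n, (z - a i)) * G z) := by
    intro n
    induction n with
    | zero => exact ⟨0, g, by simp, hg, by simp⟩
    | succ n ih =>
      obtain ⟨a, G, ha, hG, hgG⟩ := ih
      obtain ⟨b, hb, hGb⟩ := hcon n a G ha hG hgG
      refine ⟨fun i => if i < n then a i else b, dslope G b, fun i hi => ?_, ?_, fun z => ?_⟩
      · dsimp only
        split_ifs with h
        · exact ha i h
        · exact hb
      · intro z
        have := (Complex.differentiableOn_dslope (c := b) (f := G) (s := Set.univ)
          univ_mem).2 hG.differentiableOn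
        exact (this z trivial).differentiableAt univ_mem
      · rw [hgG z, Finset.prod_range_succ]
        have h1 : ∏ i ∈ Finset.range n, (z - if i < n then a i else b)
            = ∏ i ∈ Finset.range n, (z - a i) :=
          Finset.prod_congr rfl fun i hi => by rw [if_pos (Finset.mem_range.1 hi)]
        have h2 := sub_smul_dslope G b z
        rw [hGb, sub_zero, smul_eq_mul] at h2
        dsimp only
        rw [h1, if_neg (lt_irrefl n), mul_assoc, h2]
  obtain ⟨M, hM⟩ := (isCompact_sphere x (3 * R)).exists_bound_of_continuousOn
    hg.continuous.continuousOn
  obtain ⟨n, hn⟩ := exists_nat_gt ((log M - log ‖g x‖) / log 2)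
  obtain ⟨a, G, ha, hG, hgG⟩ := key n
  have h := log_cofactor_le hG hR (by linarith : R < 3 * R) ha
    (fun z hz => by rw [← hgG]; exact hM z hz) (by rwa [← hgG])
    (mem_closedBall_self (x := x) (by positivity))
    (right_ne_zero_of_mul (by rwa [← hgG]))
  rw [← hgG, show (3 * R - R) / R = 2 by field_simp; norm_num] at h
  have := log_pos one_lt_two
  rw [div_lt_iff₀ this] at hn
  linarith

/-- Borel–Carathéodory for the logarithm of the modulus of a zero-free function. -/
theorem abs_log_norm_sub_le {G : ℂ → ℂ} (hG : Differentiable ℂ G) {x : ℂ} {R A : ℝ} (hA : 0 < A)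
    (h0 : ∀ z ∈ ball x R, G z ≠ 0) (hb : ∀ z ∈ ball x R, log ‖G z‖ - log ‖G x‖ ≤ A)
    {z : ℂ} (hz : z ∈ ball x R) :
    |log ‖G z‖ - log ‖G x‖| ≤ 2 * A * ‖z - x‖ / (R - ‖z - x‖) := by
  have hR : 0 < R := pos_of_mem_ball hz
  obtain ⟨F, hF, hFre⟩ := InnerProductSpace.HarmonicOnNhd.exists_analyticOnNhd_ball_re_eq
    (f := fun z => log ‖G z‖) (z := x) (R := R)
    (fun z hz => (hG.analyticAt z).harmonicAt_log_norm (h0 z hz))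
  have hx : x ∈ ball x R := mem_ball_self hR
  have hmem : ∀ w ∈ ball (0 : ℂ) R, w + x ∈ ball x R := by
    intro w hw; simpa [dist_eq_norm] using hw
  have h := Complex.borelCaratheodory_zero (f := fun w => F (w + x) - F x) (M := A) (R := R)
    (z := z - x) hA ?_ ?_ hR (by simpa [dist_eq_norm] using hz) (by simp)
  · refine le_trans ?_ h
    have := Complex.abs_re_le_norm (F (z - x + x) - F x)
    have e1 := hFre hz
    have e2 := hFre hx
    dsimp only at e1 e2
    rw [Complex.sub_re, sub_add_cancel, e1, e2] at this
    rwa [sub_add_cancel]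
  · refine DifferentiableOn.sub_const ?_ _
    exact hF.differentiableOn.comp (by fun_prop) hmem
  · intro w hw
    have := hb _ (hmem w hw)
    have e1 := hFre (hmem w hw)
    have e2 := hFre hx
    dsimp only at e1 e2
    rw [Set.mem_ofPred_eq, Complex.sub_re, e1, e2]
    exact this

/-! ### The Poisson–Jensen inequality. -/

theorem circleAverage_poisson_log_norm {G : ℂ → ℂ} (hG : Differentiable ℂ G) {R : ℝ}
    (h0 : ∀ z ∈ closedBall 0 R, G z ≠ 0) {w : ℂ} (hw : w ∈ ball 0 R) :
    circleAverage (fun z => (herglotzRieszKernel 0 w z).re * log ‖G z‖) 0 R = log ‖G w‖ :=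
  InnerProductSpace.HarmonicOnNhd.circleAverage_re_herglotzRieszKernel_smul
    (f := fun z => log ‖G z‖) (fun z hz => (hG.analyticAt z).harmonicAt_log_norm (h0 z hz)) hw

theorem Complex.normSq_sub_conj_mul (a z : ℂ) (R : ℝ) :
    Complex.normSq (R ^ 2 - (starRingEnd ℂ) a * z) =
      R ^ 2 * Complex.normSq (z - a) +
        (R ^ 2 - Complex.normSq a) * (R ^ 2 - Complex.normSq z) := by
  simp only [Complex.normSq_apply, Complex.sub_re, Complex.sub_im, Complex.mul_re, Complex.mul_im,
    Complex.conj_re, Complex.conj_im, ← Complex.ofReal_pow, Complex.ofReal_re, Complex.ofReal_im]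
  ring

/-- This is subharmonicity of log|z-a|. For |a| < R, the function (R² - āz)/R is zero-free on the
disc, has modulus |z-a| on the circle and no smaller modulus inside. For |a| ≥ R equality holds. -/
theorem log_norm_sub_le_poisson {R : ℝ} {w a : ℂ} (hw : w ∈ ball 0 R) (hwa : w ≠ a) :
    log ‖w - a‖ ≤ circleAverage (fun z => (herglotzRieszKernel 0 w z).re * log ‖z - a‖) 0 R := by
  have hR : 0 < R := pos_of_mem_ball hw
  rcases lt_trichotomy ‖a‖ R with h | h | h
  · have hne : ∀ z ∈ closedBall (0 : ℂ) R, (R ^ 2 - (starRingEnd ℂ) a * z) / R ≠ 0 := by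
      intro z hz
      rw [mem_closedBall_zero_iff] at hz
      have : ‖(starRingEnd ℂ) a * z‖ < R ^ 2 := by
        rw [norm_mul, RCLike.norm_conj]
        nlinarith [norm_nonneg a, norm_nonneg z]
      refine div_ne_zero (fun hcon => ?_) (by exact_mod_cast hR.ne')
      rw [sub_eq_zero] at hcon
      rw [← hcon, norm_pow, Complex.norm_real, norm_eq_abs, sq_abs] at this
      exact lt_irrefl _ this
    have key : ∀ z : ℂ, ‖(R ^ 2 - (starRingEnd ℂ) a * z) / (R : ℂ)‖ ^ 2 = ‖z - a‖ ^ 2 +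
        (R ^ 2 - ‖a‖ ^ 2) * (R ^ 2 - ‖z‖ ^ 2) / R ^ 2 := by
      intro z
      rw [norm_div, div_pow, ← Complex.normSq_eq_norm_sq, Complex.normSq_sub_conj_mul,
        Complex.norm_real, norm_eq_abs, sq_abs, ← Complex.normSq_eq_norm_sq,
        ← Complex.normSq_eq_norm_sq, ← Complex.normSq_eq_norm_sq]
      field_simp
    have h1 := circleAverage_poisson_log_norm
      (G := fun z => (R ^ 2 - (starRingEnd ℂ) a * z) / (R : ℂ)) (by fun_prop) hne hw
    rw [circleAverage_congr_sphere
      (f₂ := fun z => (herglotzRieszKernel 0 w z).re * log ‖z - a‖)] at h1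
    · rw [h1]
      refine Real.log_le_log (norm_pos_iff.2 (sub_ne_zero.2 hwa)) ?_
      refine le_of_sq_le_sq ?_ (norm_nonneg _)
      rw [key]
      rw [mem_ball_zero_iff] at hw
      have : 0 ≤ (R ^ 2 - ‖a‖ ^ 2) * (R ^ 2 - ‖w‖ ^ 2) / R ^ 2 := by
        refine div_nonneg (mul_nonneg ?_ ?_) (by positivity) <;>
        nlinarith [norm_nonneg a, norm_nonneg w]
      linarith
    · intro z hz
      rw [abs_of_pos hR, mem_sphere_zero_iff_norm] at hz
      have := key z
      rw [hz, sub_self, mul_zero, zero_div, add_zero] at this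
      have := (pow_left_inj₀ (norm_nonneg _) (norm_nonneg _) two_ne_zero).1 this
      simp only [this]
  · exact (circleAverage_re_herglotzRieszKernel_mul_log₀ (by simpa using h) hw).ge
  · refine (circleAverage_poisson_log_norm (G := fun z => z - a) (by fun_prop) ?_ hw).ge
    intro z hz hcon
    rw [mem_closedBall_zero_iff, sub_eq_zero.1 hcon] at hz
    linarith

theorem CircleIntegrable.re_herglotz_mul {f : ℂ → ℝ} {R : ℝ} (hf : CircleIntegrable f 0 R) {w : ℂ}
    (hw : w ∈ ball 0 R) :
    CircleIntegrable (fun z => (herglotzRieszKernel 0 w z).re * f z) 0 R :=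
  hf.continuousOn_mul
    (Complex.continuous_re.comp_continuousOn (continuousOn_herglotzRieszKernel_sphere hw))

theorem posLog_norm_le_characteristic {g : ℂ → ℂ} (hg : Differentiable ℂ g) {w : ℂ}
    {R : ℝ} (hw : ‖w‖ < R) :
    log⁺ ‖g w‖ ≤ (R + ‖w‖) / (R - ‖w‖) * ValueDistribution.characteristic g ⊤ R := by
  have hR : 0 < R := (norm_nonneg w).trans_lt hw
  have hwb : w ∈ ball 0 R := by simpa using hw
  have hT : 0 ≤ ValueDistribution.characteristic g ⊤ R := by
    rw [hg.characteristic_top_eq]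
    exact circleAverage_nonneg_of_nonneg fun _ _ => posLog_nonneg
  have hq : 0 ≤ (R + ‖w‖) / (R - ‖w‖) := div_nonneg (by positivity) (by linarith)
  by_cases hgw : g w = 0
  · rw [hgw, norm_zero, posLog_zero]
    positivity
  rw [posLog_apply]
  refine max_le (by positivity) ?_
  -- The ball is centred at `w`, where `g` is nonzero; radius `2 * R` makes it cover the disc of
  -- radius `R` about 0.
  obtain ⟨n, a, G, -, hG, hgG, hG0⟩ :=
    exists_eq_prod_mul_of_differentiable hg hgw (R := 2 * R) (by positivity)
  have hlog : ∀ z, (∀ i ∈ Finset.range n, z ≠ a i) → G z ≠ 0 →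
      log ‖g z‖ = ∑ i ∈ Finset.range n, log ‖z - a i‖ + log ‖G z‖ := by
    intro z h1 h2
    have h3 : ∀ i ∈ Finset.range n, ‖z - a i‖ ≠ 0 := fun i hi =>
      norm_ne_zero_iff.2 (sub_ne_zero.2 (h1 i hi))
    rw [hgG, norm_mul, norm_prod, Real.log_mul (Finset.prod_ne_zero_iff.2 h3)
      (norm_ne_zero_iff.2 h2), Real.log_prod h3]
  have hwa : ∀ i ∈ Finset.range n, w ≠ a i := by
    intro i hi hcon
    refine hgw ?_
    rw [hgG, Finset.prod_eq_zero hi (sub_eq_zero.2 hcon), zero_mul]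
  have hball : closedBall 0 R ⊆ closedBall w (2 * R) :=
    closedBall_subset_closedBall' (by rw [dist_zero_left]; linarith)
  have hGR : ∀ z ∈ closedBall 0 R, G z ≠ 0 := fun z hz => hG0 z (hball hz)
  have hKpos : ∀ z ∈ sphere (0 : ℂ) |R|, 0 ≤ (herglotzRieszKernel 0 w z).re ∧
      (herglotzRieszKernel 0 w z).re ≤ (R + ‖w‖) / (R - ‖w‖) := by
    intro z hz
    rw [abs_of_pos hR] at hz
    have h1 := re_herglotzRieszKernel_le hz hwb
    have h2 := le_re_herglotzRieszKernel hz hwb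
    rw [sub_zero w] at h1 h2
    rw [herglotzRieszKernel_def, sub_zero w]
    refine ⟨le_trans ?_ h2, h1⟩
    exact div_nonneg (by linarith) (by positivity)
  have hint : ∀ i, CircleIntegrable (fun z => (herglotzRieszKernel 0 w z).re * log ‖z - a i‖) 0 R :=
    fun i => (circleIntegrable_log_norm_sub (a i) 0 R).re_herglotz_mul hwb
  have hintG : CircleIntegrable (fun z => (herglotzRieszKernel 0 w z).re * log ‖G z‖) 0 R := by
    refine CircleIntegrable.re_herglotz_mul ?_ hwb
    exact MeromorphicOn.circleIntegrable_log_norm fun z _ => (hG.analyticAt z).meromorphicAt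
  have hintS : CircleIntegrable (fun z => ∑ i ∈ Finset.range n,
      (herglotzRieszKernel 0 w z).re * log ‖z - a i‖) 0 R :=
    CircleIntegrable.fun_sum _ fun i _ => hint i
  calc log ‖g w‖ = ∑ i ∈ Finset.range n, log ‖w - a i‖ + log ‖G w‖ :=
        hlog w hwa (hGR w (ball_subset_closedBall hwb))
    _ ≤ ∑ i ∈ Finset.range n,
          circleAverage (fun z => (herglotzRieszKernel 0 w z).re * log ‖z - a i‖) 0 R +
        circleAverage (fun z => (herglotzRieszKernel 0 w z).re * log ‖G z‖) 0 R := by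
      rw [circleAverage_poisson_log_norm hG hGR hwb]
      gcongr with i hi
      exact log_norm_sub_le_poisson hwb (hwa i hi)
    _ = circleAverage (fun z => (∑ i ∈ Finset.range n,
          (herglotzRieszKernel 0 w z).re * log ‖z - a i‖) +
          (herglotzRieszKernel 0 w z).re * log ‖G z‖) 0 R := by
      rw [circleAverage_fun_add hintS hintG, circleAverage_fun_sum fun i _ => hint i]
    _ ≤ circleAverage (fun z => ((R + ‖w‖) / (R - ‖w‖)) • log⁺ ‖g z‖) 0 R := by
      refine circleAverage_mono_of_countable (S := a '' Set.Iio n) hR.ne'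
        ((Set.finite_Iio n).image a).countable (hintS.add hintG)
        ((hg.circleIntegrable_posLog 0 R).const_mul _) fun z hz hza => ?_
      rw [← Finset.mul_sum, ← mul_add, ← hlog z ?_ (hGR z ?_), smul_eq_mul]
      · refine (mul_le_mul_of_nonneg_left (le_max_right 0 _) (hKpos z hz).1).trans ?_
        exact mul_le_mul_of_nonneg_right (hKpos z hz).2 posLog_nonneg
      · rintro i hi rfl
        exact hza ⟨i, Finset.mem_range.1 hi, rfl⟩
      · rw [abs_of_pos hR] at hz
        exact sphere_subset_closedBall hz
    _ = _ := by
      rw [circleAverage_fun_smul, hg.characteristic_top_eq, smul_eq_mul]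

/-! ### Comparing values of an entire function on comparable circles. -/

/-- The average of the logarithmic bound for a quotient of linear factors. -/
theorem circleAverage_log_sub_log_norm_sub_le {K r : ℝ} (hK : 0 < K) (hr : 0 < r) (a : ℂ) :
    circleAverage (fun z => log (K * (r + ‖a‖)) - log ‖z - a‖) 0 r ≤ log (2 * K) := by
  rw [circleAverage_fun_sub (circleIntegrable_const _ _ _) (circleIntegrable_log_norm_sub a 0 r),
    circleAverage_const, circleAverage_log_norm_sub_const_eq_log_radius_add_posLog hr.ne',
    zero_sub, norm_neg]
  have h1 : log (r + ‖a‖) ≤ log 2 + (log r + log⁺ (r⁻¹ * ‖a‖)) := by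
    have h2 : r + ‖a‖ ≤ 2 * (r * max 1 (r⁻¹ * ‖a‖)) := by
      have e1 : r * (r⁻¹ * ‖a‖) = ‖a‖ := by field_simp
      have e2 := mul_le_mul_of_nonneg_left (le_max_left 1 (r⁻¹ * ‖a‖)) hr.le
      have e3 := mul_le_mul_of_nonneg_left (le_max_right 1 (r⁻¹ * ‖a‖)) hr.le
      linarith
    have hm : 0 < max 1 (r⁻¹ * ‖a‖) := lt_max_of_lt_left one_pos
    rw [posLog_eq_log_max_one (by positivity), ← Real.log_mul hr.ne' hm.ne',
      ← Real.log_mul two_ne_zero (by positivity)]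
    exact Real.log_le_log (by positivity) h2
  rw [Real.log_mul hK.ne' (by positivity), Real.log_mul two_ne_zero hK.ne']
  linarith

/-- The sum compares the linear factors at `w` and `z`; the remaining term is Borel–Carathéodory
applied to the cofactor at both points. -/
theorem exists_norm_le_exp_mul_norm {g : ℂ → ℂ} (hg : Differentiable ℂ g) {x : ℂ} (hx : g x ≠ 0)
    {R S M : ℝ} (hR : 0 < R) (hRS : 2 * R ≤ S) (hM : ∀ z ∈ sphere x S, ‖g z‖ ≤ M) :
    ∃ (n : ℕ) (a : ℕ → ℂ), n * log ((S - R) / R) ≤ log M - log ‖g x‖ ∧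
      ∀ K r : ℝ, 1 ≤ K → 1 ≤ r → K * r + ‖x‖ < R → ∀ z w : ℂ, ‖z‖ = r → ‖w‖ ≤ K * r → g z ≠ 0 →
        0 ≤ ∑ i ∈ Finset.range n, (log (K * (r + ‖a i‖)) - log ‖z - a i‖) ∧
        ‖g w‖ ≤ exp (∑ i ∈ Finset.range n, (log (K * (r + ‖a i‖)) - log ‖z - a i‖) +
          4 * (log M - log ‖g x‖ + 1) * (K * r + ‖x‖) / (R - (K * r + ‖x‖))) * ‖g z‖ := by
  obtain ⟨n, a, G, ha, hG, hgG, hG0⟩ := exists_eq_prod_mul_of_differentiable hg hx hR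
  have hlc := fun z hz hGz => log_cofactor_le hG hR (by linarith : R < S) ha
    (fun z hz => by rw [← hgG]; exact hM z hz) (by rwa [← hgG]) (z := z) hz hGz
  rw [← hgG] at hlc
  have hlogpos : 0 ≤ n * log ((S - R) / R) := by
    refine mul_nonneg (Nat.cast_nonneg n) (Real.log_nonneg ?_)
    rw [le_div_iff₀ hR]
    linarith
  have hA := hlc x (mem_closedBall_self (by linarith)) (hG0 x (mem_closedBall_self hR.le))
  rw [sub_self, zero_add] at hA
  refine ⟨n, a, hA, fun K r hK hr hKr z w hz hw hgz => ?_⟩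
  set A := log M - log ‖g x‖
  set ρ := K * r + ‖x‖ with hρ
  have hKr1 : r ≤ K * r := by nlinarith
  have hza : ∀ i ∈ Finset.range n, z ≠ a i := by
    intro i hi hcon
    refine hgz ?_
    rw [hgG, Finset.prod_eq_zero hi (sub_eq_zero.2 hcon), zero_mul]
  have hfac : ∀ i ∈ Finset.range n, ∀ v : ℂ, ‖v‖ ≤ K * r → ‖v - a i‖ ≤ K * (r + ‖a i‖) := by
    intro i _ v hv
    have := norm_sub_le v (a i)
    nlinarith [norm_nonneg (a i)]
  have hpos : 0 ≤ ∑ i ∈ Finset.range n, (log (K * (r + ‖a i‖)) - log ‖z - a i‖) := by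
    refine Finset.sum_nonneg fun i hi => sub_nonneg.2 (Real.log_le_log ?_ ?_)
    · exact norm_pos_iff.2 (sub_ne_zero.2 (hza i hi))
    · exact hfac i hi z (hz ▸ hKr1)
  refine ⟨hpos, ?_⟩
  have hmem : ∀ v : ℂ, ‖v‖ ≤ K * r → ‖v - x‖ ≤ ρ := fun v hv =>
    (norm_sub_le v x).trans (by linarith)
  have hest : ∀ v : ℂ, ‖v‖ ≤ K * r → v ∈ closedBall x R ∧
      |log ‖G v‖ - log ‖G x‖| ≤ 2 * (A + 1) * ρ / (R - ρ) := by
    intro v hv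
    have h1 := hmem v hv
    have hvb : v ∈ ball x R := by rw [mem_ball, dist_eq_norm]; linarith
    refine ⟨ball_subset_closedBall hvb, ?_⟩
    -- `A` may be zero, whereas Borel–Carathéodory needs a positive bound.
    refine (abs_log_norm_sub_le hG (A := A + 1) (by linarith)
      (fun y hy => hG0 y (ball_subset_closedBall hy)) (fun y hy => ?_) hvb).trans ?_
    · have := hlc y (closedBall_subset_closedBall (by linarith) (ball_subset_closedBall hy))
        (hG0 y (ball_subset_closedBall hy))
      linarith
    · have : 0 ≤ A := hlogpos.trans hA
      have : 0 < R - ρ := by linarith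
      gcongr
  obtain ⟨hzb, hz1⟩ := hest z (hz ▸ hKr1)
  obtain ⟨hwb, hw1⟩ := hest w hw
  have hGw : ‖G w‖ ≤ exp (4 * (A + 1) * ρ / (R - ρ)) * ‖G z‖ := by
    rw [← Real.log_le_log_iff (norm_pos_iff.2 (hG0 w hwb))
      (mul_pos (exp_pos _) (norm_pos_iff.2 (hG0 z hzb))),
      Real.log_mul (exp_pos _).ne' (norm_ne_zero_iff.2 (hG0 z hzb)), Real.log_exp]
    have e : 4 * (A + 1) * ρ / (R - ρ) = 2 * (2 * (A + 1) * ρ / (R - ρ)) := by ring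
    rw [e]
    linarith [(abs_le.1 hz1).1, (abs_le.1 hw1).2]
  rw [hgG w, hgG z, norm_mul, norm_mul, Real.exp_add, Real.exp_sum, norm_prod, norm_prod]
  calc _ ≤ (∏ i ∈ Finset.range n, exp (log (K * (r + ‖a i‖)) - log ‖z - a i‖) * ‖z - a i‖) *
        (exp (4 * (A + 1) * ρ / (R - ρ)) * ‖G z‖) := by
        refine mul_le_mul (Finset.prod_le_prod (fun _ _ => norm_nonneg _) fun i hi => ?_) hGw
          (norm_nonneg _) (Finset.prod_nonneg fun i _ => by positivity)
        have h1 := norm_pos_iff.2 (sub_ne_zero.2 (hza i hi))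
        rw [Real.exp_sub, Real.exp_log h1, Real.exp_log (by positivity), div_mul_cancel₀ _ h1.ne']
        exact hfac i hi w hw
    _ = _ := by rw [Finset.prod_mul_distrib]; ring

/-- Pointwise comparison of the values of an entire function of finite logarithmic order on
comparable circles. -/
theorem eventually_exists_norm_le_exp_mul_norm {g : ℂ → ℂ} (hg : Differentiable ℂ g) {x : ℂ}
    (hx : g x ≠ 0) {β : ℝ} (hβ : 0 ≤ β)
    (hT : ∀ᶠ r in atTop, ValueDistribution.characteristic g ⊤ r ≤ log r ^ (β + 1))
    {K : ℝ} (hK : 1 ≤ K) :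
    ∃ C : ℝ, ∀ᶠ r in atTop, ∃ (n : ℕ) (a : ℕ → ℂ), n ≤ C * log r ^ β ∧
      ∀ z w : ℂ, ‖z‖ = r → ‖w‖ ≤ K * r → g z ≠ 0 →
        0 ≤ ∑ i ∈ Finset.range n, (log (K * (r + ‖a i‖)) - log ‖z - a i‖) ∧
        ‖g w‖ ≤ exp (∑ i ∈ Finset.range n, (log (K * (r + ‖a i‖)) - log ‖z - a i‖) + 1) *
          ‖g z‖ := by
  -- The 3 is the Poisson kernel bound at half the radius; the 5 comes from log(2(r⁴ + |x|)) ≤ 5 log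
  -- r.
  set C : ℝ := 3 * 5 ^ (β + 1) + |log ‖g x‖| with hC
  have hCpos : 0 < C := by positivity
  have hT' : ∀ᶠ r : ℝ in atTop, ValueDistribution.characteristic g ⊤ (2 * (r ^ 4 + ‖x‖)) ≤
      log (2 * (r ^ 4 + ‖x‖)) ^ (β + 1) := by
    have : Tendsto (fun r : ℝ => 2 * (r ^ 4 + ‖x‖)) atTop atTop :=
      Tendsto.const_mul_atTop two_pos
        (tendsto_atTop_add_const_right _ _ (tendsto_pow_atTop (by norm_num)))
    exact this.eventually hT
  have hsmall : ∀ᶠ r : ℝ in atTop, 8 * (C + 1) * (K + 1) * log r ^ (β + 1) ≤ r := by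
    have h1 := (isLittleO_log_rpow_rpow_atTop (s := 1) (β + 1) one_pos).bound
      (c := (8 * (C + 1) * (K + 1))⁻¹) (by positivity)
    filter_upwards [h1, eventually_ge_atTop 1] with r h1 hr
    rw [Real.rpow_one, Real.norm_of_nonneg (Real.rpow_nonneg (Real.log_nonneg hr) _),
      Real.norm_of_nonneg (by positivity), inv_mul_eq_div, le_div_iff₀ (by positivity)] at h1
    linarith
  refine ⟨C, ?_⟩
  filter_upwards [hT', hsmall, eventually_ge_atTop 4, eventually_ge_atTop ‖x‖,
    eventually_ge_atTop (exp 1), eventually_ge_atTop (2 * (K + 1) + 1)] with r hT' hsmall h4 hxr he hKr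
  have hlog : 1 ≤ log r := by rwa [Real.le_log_iff_exp_le (by linarith)]
  have hL1 : 1 ≤ log r ^ (β + 1) := Real.one_le_rpow hlog (by linarith)
  set T := ValueDistribution.characteristic g ⊤ (2 * (r ^ 4 + ‖x‖)) with hTdef
  have hr4 : 0 < r ^ 4 := by positivity
  have hTL : T ≤ 5 ^ (β + 1) * log r ^ (β + 1) := by
    rw [← Real.mul_rpow (by norm_num) (by linarith)]
    refine hT'.trans (Real.rpow_le_rpow (Real.log_nonneg ?_) ?_ (by linarith))
    · have := norm_nonneg x
      have : 1 ≤ r ^ 4 := one_le_pow₀ (by linarith)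
      linarith
    · have : (5 : ℝ) * log r = log (r ^ 5) := by rw [Real.log_pow]; norm_num
      rw [this]
      refine Real.log_le_log (by positivity) ?_
      have : r ≤ r ^ 4 := le_self_pow₀ (by linarith) (by norm_num)
      nlinarith
  have hM : ∀ z ∈ sphere x (r ^ 4), ‖g z‖ ≤ exp (3 * T) := by
    intro z hz
    have hzn : ‖z‖ ≤ r ^ 4 + ‖x‖ := by
      rw [mem_sphere, dist_eq_norm] at hz
      have := norm_add_le (z - x) x
      rwa [sub_add_cancel, hz] at this
    have hs : 0 < r ^ 4 + ‖x‖ := by positivity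
    have h1 := posLog_norm_le_characteristic hg (w := z) (R := 2 * (r ^ 4 + ‖x‖)) (by linarith)
    have hTnn : 0 ≤ T := by
      rw [hTdef, hg.characteristic_top_eq]
      exact circleAverage_nonneg_of_nonneg fun _ _ => posLog_nonneg
    have h2 : log⁺ ‖g z‖ ≤ 3 * T := by
      refine h1.trans (mul_le_mul_of_nonneg_right ?_ hTnn)
      rw [div_le_iff₀ (by linarith)]
      linarith
    rcases eq_or_ne (g z) 0 with h0 | h0
    · rw [h0, norm_zero]; positivity
    · rw [← Real.log_le_iff_le_exp (norm_pos_iff.2 h0)]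
      exact (le_max_right 0 _).trans h2
  have hr2 : 2 * r ^ 2 ≤ r ^ 4 := by
    have : 2 ≤ r ^ 2 := by nlinarith
    nlinarith [sq_nonneg r]
  -- The ratio of these radii makes each zero cost at least log r, and `R = r ^ 2` is so much larger
  -- than `K * r` that the cofactor term is O((log r)^(β+1) / r).
  obtain ⟨n, a, hn, h⟩ := exists_norm_le_exp_mul_norm hg hx (R := r ^ 2) (S := r ^ 4)
    (by positivity) hr2 hM
  rw [Real.log_exp] at hn h
  have hA : 3 * T - log ‖g x‖ ≤ C * log r ^ (β + 1) := by
    have := neg_abs_le (log ‖g x‖)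
    have : |log ‖g x‖| ≤ |log ‖g x‖| * log r ^ (β + 1) := le_mul_of_one_le_right (abs_nonneg _) hL1
    rw [hC, add_mul]
    linarith
  have hρ : K * r + ‖x‖ ≤ (K + 1) * r := by linarith
  have hρR : r ^ 2 ≤ 2 * (r ^ 2 - (K * r + ‖x‖)) := by nlinarith
  refine ⟨n, a, ?_, fun z w hz hw hgz => ?_⟩
  · have h1 : log r ≤ log ((r ^ 4 - r ^ 2) / r ^ 2) := by
      refine Real.log_le_log (by linarith) ?_
      rw [le_div_iff₀ (by positivity)]
      have : r ^ 2 * (r + 1) ≤ r ^ 2 * r ^ 2 := by gcongr; nlinarith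
      nlinarith
    have h2 : n * log r ≤ C * log r ^ β * log r := by
      rw [mul_assoc, ← Real.rpow_add_one (by linarith : log r ≠ 0)]
      exact (mul_le_mul_of_nonneg_left h1 (Nat.cast_nonneg n)).trans (hn.trans hA)
    exact le_of_mul_le_mul_right h2 (by linarith)
  · obtain ⟨h1, h2⟩ := h K r hK (by linarith) (by nlinarith) z w hz hw hgz
    refine ⟨h1, h2.trans ?_⟩
    gcongr
    rw [div_le_one (by nlinarith)]
    have h3 : 3 * T - log ‖g x‖ + 1 ≤ (C + 1) * log r ^ (β + 1) := by linarith
    have h4 : 4 * (3 * T - log ‖g x‖ + 1) * (K * r + ‖x‖) ≤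
        4 * ((C + 1) * log r ^ (β + 1)) * ((K + 1) * r) := by
      gcongr
    nlinarith

/-! ### Affine orbits and iterates of the Hahn operator. -/

theorem norm_affine_iterate_le (q c z : ℂ) (hz : 1 ≤ ‖z‖) (i : ℕ) :
    ‖(fun w => q * w + c)^[i] z‖ ≤ (‖q‖ + ‖c‖ + 1) ^ i * ‖z‖ := by
  induction i with
  | zero => simp
  | succ i ih =>
    rw [Function.iterate_succ_apply']
    have h1 : 1 ≤ (‖q‖ + ‖c‖ + 1) ^ i * ‖z‖ :=
      one_le_mul_of_one_le_of_one_le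
        (one_le_pow₀ (by linarith [norm_nonneg q, norm_nonneg c])) hz
    have h2 := norm_add_le (q * (fun w => q * w + c)^[i] z) c
    rw [norm_mul] at h2
    have h3 := mul_le_mul_of_nonneg_left ih (norm_nonneg q)
    have h4 := mul_le_mul_of_nonneg_left h1 (norm_nonneg c)
    rw [pow_succ]
    nlinarith

theorem affine_iterate_sub (q c z : ℂ) (i : ℕ) :
    (q - 1) * (fun w => q * w + c)^[i] z + c = q ^ i * ((q - 1) * z + c) := by
  induction i with
  | zero => simp
  | succ i ih =>
    rw [Function.iterate_succ_apply', pow_succ']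
    linear_combination q * ih

/-- With denominators of modulus at least 1 along the orbit, each application of the operator at
most doubles the bound. -/
theorem norm_hahnDiff_iterate_le {q c z : ℂ} {g : ℂ → ℂ} {M : ℝ} {k : ℕ}
    (hM : ∀ l ≤ k, ‖g ((fun w => q * w + c)^[l] z)‖ ≤ M)
    (h1 : ∀ i < k, 1 ≤ ‖(q - 1) * (fun w => q * w + c)^[i] z + c‖) :
    ∀ j i, i + j ≤ k → ‖(hahnDiff q c)^[j] g ((fun w => q * w + c)^[i] z)‖ ≤ 2 ^ j * M := by
  intro j
  induction j with
  | zero => intro i hi; simpa using hM i hi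
  | succ j ih =>
    intro i hi
    have e1 := ih i (by omega)
    have e2 := ih (i + 1) (by omega)
    rw [Function.iterate_succ_apply'] at e2 ⊢
    have h3 := h1 i (by omega)
    unfold hahnDiff
    rw [norm_div]
    refine (div_le_self (norm_nonneg _) h3).trans ((norm_sub_le _ _).trans ?_)
    rw [pow_succ]
    unfold hahnDiff at e1 e2
    linarith

/-! ### Logarithmic order and growth of the characteristic. -/

theorem eventually_characteristic_le_of_logOrder_lt {f : ℂ → ℂ} {β : ℝ}
    (h : logOrder f < (β : EReal)) :
    ∀ᶠ r in atTop, ValueDistribution.characteristic f ⊤ r ≤ log r ^ β := by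
  filter_upwards [eventually_lt_of_limsup_lt h, eventually_gt_atTop (exp 1)] with r hr he
  rw [EReal.coe_lt_coe_iff] at hr
  have hlog : 1 < log r := by rwa [Real.lt_log_iff_exp_lt ((exp_pos 1).trans he)]
  have hll : 0 < log (log r) := Real.log_pos hlog
  rw [div_lt_iff₀ hll] at hr
  rcases le_or_gt (ValueDistribution.characteristic f ⊤ r) 0 with h0 | h0
  · exact h0.trans (Real.rpow_nonneg (by linarith) _)
  · rw [Real.rpow_def_of_pos (by linarith), ← Real.log_le_iff_le_exp h0, mul_comm]
    exact (le_max_right 0 _).trans hr.le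

theorem logOrder_le_of_eventually_characteristic_le {f : ℂ → ℂ} {β : ℝ} (hβ : 0 ≤ β)
    (h : ∀ᶠ r in atTop, ValueDistribution.characteristic f ⊤ r ≤ log r ^ β)
    (h0 : ∀ᶠ r in atTop, 0 ≤ ValueDistribution.characteristic f ⊤ r) :
    logOrder f ≤ (β : EReal) := by
  refine limsup_le_of_le (by isBoundedDefault) ?_
  filter_upwards [h, h0, eventually_gt_atTop (exp 1)] with r hr hr0 he
  rw [EReal.coe_le_coe_iff]
  have hlog : 1 < log r := by rwa [Real.lt_log_iff_exp_lt ((exp_pos 1).trans he)]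
  have hll : 0 < log (log r) := Real.log_pos hlog
  rw [div_le_iff₀ hll, posLog_apply]
  refine max_le (by positivity) ?_
  rcases hr0.eq_or_lt with h1 | h1
  · rw [← h1, Real.log_zero]; positivity
  · rw [Real.log_le_iff_le_exp h1, mul_comm]
    rwa [Real.rpow_def_of_pos (by linarith)] at hr

/-- A smaller order gives T(r,g) = o(log r), hence |g| ≤ r^(1/2) on |z| ≤ r/2, and Cauchy's estimate
kills the derivative. -/
theorem one_le_logOrder {g : ℂ → ℂ} (hg : Differentiable ℂ g) (hgc : ¬ ∃ a : ℂ, ∀ z, g z = a) :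
    1 ≤ logOrder g := by
  by_contra! hlt
  obtain ⟨β, hβ1, hβ2⟩ := EReal.lt_iff_exists_real_btwn.1 hlt
  rw [show (1 : EReal) = ((1 : ℝ) : EReal) from rfl, EReal.coe_lt_coe_iff] at hβ2
  have hT := eventually_characteristic_le_of_logOrder_lt hβ1
  have hsmall : ∀ᶠ r : ℝ in atTop, log r ^ β ≤ 1 / 6 * log r := by
    have h1 := ((tendsto_rpow_neg_atTop (y := 1 - β) (by linarith)).comp
      Real.tendsto_log_atTop).eventually (eventually_le_nhds (by norm_num : (0 : ℝ) < 1 / 6))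
    filter_upwards [h1, eventually_gt_atTop 1] with r h1 hr
    have hl := Real.log_pos hr
    rw [Function.comp_apply, neg_sub, Real.rpow_sub_one hl.ne', div_le_iff₀ hl] at h1
    exact h1
  have hgrow : ∀ᶠ r : ℝ in atTop, ∀ z : ℂ, 2 * ‖z‖ ≤ r → ‖g z‖ ≤ r ^ (1 / 2 : ℝ) := by
    filter_upwards [hT, hsmall, eventually_ge_atTop 1] with r hT hs hr z hz
    have h1 := posLog_norm_le_characteristic hg (w := z) (R := r) (by linarith [norm_nonneg z])
    have hTnn : 0 ≤ ValueDistribution.characteristic g ⊤ r := by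
      rw [hg.characteristic_top_eq]
      exact circleAverage_nonneg_of_nonneg fun _ _ => posLog_nonneg
    have h2 : log⁺ ‖g z‖ ≤ 3 * ValueDistribution.characteristic g ⊤ r := by
      refine h1.trans (mul_le_mul_of_nonneg_right ?_ hTnn)
      rw [div_le_iff₀ (by linarith)]
      linarith
    rcases eq_or_ne (g z) 0 with h0 | h0
    · rw [h0, norm_zero]; positivity
    · rw [Real.rpow_def_of_pos (by linarith), ← Real.log_le_iff_le_exp (norm_pos_iff.2 h0)]
      have := (le_max_right 0 _).trans h2
      linarith
  have hderiv : ∀ z, deriv g z = 0 := by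
    intro z
    have hlim : Tendsto (fun r : ℝ => 4 * r ^ (-(1 / 2) : ℝ)) atTop (𝓝 0) := by
      simpa using (tendsto_rpow_neg_atTop (y := 1 / 2) (by norm_num)).const_mul 4
    have hle : ∀ᶠ r : ℝ in atTop, ‖deriv g z‖ ≤ 4 * r ^ (-(1 / 2) : ℝ) := by
      filter_upwards [hgrow, eventually_ge_atTop 1, eventually_ge_atTop (4 * ‖z‖)]
        with r hr h1 hz
      have := Complex.norm_deriv_le_of_forall_mem_sphere_norm_le (f := g) (c := z) (R := r / 4)
        (C := r ^ (1 / 2 : ℝ)) (by linarith) hg.diffContOnCl (fun w hw => hr w ?_)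
      · refine this.trans (le_of_eq ?_)
        rw [div_div_eq_mul_div, mul_comm, mul_div_assoc, ← Real.rpow_sub_one (by linarith)]
        norm_num
      · rw [mem_sphere, dist_eq_norm] at hw
        have := norm_add_le (w - z) z
        rw [sub_add_cancel] at this
        linarith
    exact norm_le_zero_iff.1 (ge_of_tendsto hlim hle)
  exact hgc ⟨g 0, fun z => is_const_of_deriv_eq_zero hg hderiv z 0⟩

/-! ### The coefficient estimate and the conclusion. -/

theorem eventually_characteristic_coeff_le {q c : ℂ} (hq0 : q ≠ 0) (hq1 : q ≠ 1)
    {k : ℕ} (hk : 1 ≤ k) {A : ℕ → ℂ → ℂ} (hA : ∀ j < k, Differentiable ℂ (A j))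
    {g : ℂ → ℂ} (hg : Differentiable ℂ g) {x : ℂ} (hx : g x ≠ 0)
    (heq : ∀ z : ℂ, (q - 1) * z + c ≠ 0 →
      (hahnDiff q c)^[k] g z + ∑ j ∈ Finset.range k, A j z * (hahnDiff q c)^[j] g z = 0)
    {β : ℝ} (hβ : 0 ≤ β)
    (hT : ∀ᶠ r in atTop, ValueDistribution.characteristic g ⊤ r ≤ log r ^ (β + 1)) :
    ∃ C : ℝ, ∀ᶠ r in atTop, ValueDistribution.characteristic (A 0) ⊤ r ≤
      C + ∑ j ∈ Finset.Ico 1 k, ValueDistribution.characteristic (A j) ⊤ r + C * log r ^ β := by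
  set K : ℝ := (‖q‖ + ‖c‖ + 1) ^ k with hKdef
  have hL1 : 1 ≤ ‖q‖ + ‖c‖ + 1 := by linarith [norm_nonneg q, norm_nonneg c]
  have hK : 1 ≤ K := one_le_pow₀ hL1
  obtain ⟨C, hC⟩ := eventually_exists_norm_le_exp_mul_norm hg hx hβ hT hK
  have hlarge : ∀ᶠ r : ℝ in atTop, ∀ z : ℂ, ‖z‖ = r → ∀ i < k,
      1 ≤ ‖(q - 1) * (fun w => q * w + c)^[i] z + c‖ := by
    have h1 : ∀ i ∈ Finset.range k, ∀ᶠ r : ℝ in atTop,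
        1 ≤ ‖q‖ ^ i * (‖q - 1‖ * r - ‖c‖) := by
      intro i _
      refine Tendsto.eventually_ge_atTop (Tendsto.const_mul_atTop ?_ ?_) 1
      · have := norm_pos_iff.2 hq0; positivity
      · exact tendsto_atTop_add_const_right _ (-‖c‖)
          (tendsto_id.const_mul_atTop (norm_pos_iff.2 (sub_ne_zero.2 hq1)))
    filter_upwards [(Filter.eventually_all_finset _).2 h1] with r hr z hz i hi
    refine (hr i (Finset.mem_range.2 hi)).trans ?_
    rw [affine_iterate_sub, norm_mul, norm_pow]
    gcongr
    have := norm_sub_le ((q - 1) * z + c) c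
    rw [add_sub_cancel_right, norm_mul, hz] at this
    linarith
  -- The summands come from the factor 2^k, the 1 in exp(B+1), and log⁺ of 1 + ∑|A_j| (two terms).
  -- For `k = 1` the last is `log 0 = 0`.
  refine ⟨max (k * log 2 + 1 + log 2 + log (Finset.Ico 1 k).card) (C * log (2 * K)), ?_⟩
  filter_upwards [hC, hlarge, eventually_ge_atTop 1] with r hr hlarge hr1
  obtain ⟨n, a, hn, hna⟩ := hr
  have hr0 : 0 < r := by linarith
  have hintb : ∀ i ∈ Finset.range n,
      CircleIntegrable (fun z => log (K * (r + ‖a i‖)) - log ‖z - a i‖) 0 r :=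
    fun i _ => (circleIntegrable_const _ _ _).sub (circleIntegrable_log_norm_sub (a i) 0 r)
  have hintA : ∀ j ∈ Finset.Ico 1 k, CircleIntegrable (fun z => log⁺ ‖A j z‖) 0 r :=
    fun j hj => (hA j (Finset.mem_Ico.1 hj).2).circleIntegrable_posLog 0 r
  have hlogn : 0 ≤ log (Finset.Ico 1 k).card := Real.log_natCast_nonneg _
  set D : ℝ := k * log 2 + 1 + log 2 + log (Finset.Ico 1 k).card with hD
  have hpoint : ∀ z ∈ sphere (0 : ℂ) |r|, z ∉ {z | g z = 0} → log⁺ ‖A 0 z‖ ≤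
      D + (∑ j ∈ Finset.Ico 1 k, log⁺ ‖A j z‖ +
        ∑ i ∈ Finset.range n, (log (K * (r + ‖a i‖)) - log ‖z - a i‖)) := by
    intro z hz hgz
    rw [abs_of_pos hr0, mem_sphere_zero_iff_norm] at hz
    have hzpos : 0 < ‖g z‖ := norm_pos_iff.2 hgz
    set B := ∑ i ∈ Finset.range n, (log (K * (r + ‖a i‖)) - log ‖z - a i‖)
    have hB0 : 0 ≤ B := (hna z z hz (by rw [hz]; nlinarith) hgz).1
    have hMl : ∀ l ≤ k, ‖g ((fun w => q * w + c)^[l] z)‖ ≤ exp (B + 1) * ‖g z‖ := by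
      intro l hl
      refine (hna z _ hz ?_ hgz).2
      refine (norm_affine_iterate_le q c z (by linarith) l).trans ?_
      rw [hz]
      gcongr
      exact pow_le_pow_right₀ hL1 hl
    have hDj : ∀ j ≤ k, ‖(hahnDiff q c)^[j] g z‖ ≤ 2 ^ k * (exp (B + 1) * ‖g z‖) := by
      intro j hj
      refine (norm_hahnDiff_iterate_le hMl (hlarge z hz) j 0 (by omega)).trans ?_
      gcongr
      norm_num
    have hz0 : (q - 1) * z + c ≠ 0 := by
      have := hlarge z hz 0 (by omega)
      rw [Function.iterate_zero, id] at this
      exact norm_pos_iff.1 (by linarith)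
    have h0 := heq z hz0
    rw [Finset.range_eq_Ico, Finset.sum_eq_sum_Ico_succ_bot (by omega)] at h0
    have h1 : A 0 z * g z =
        -((hahnDiff q c)^[k] g z + ∑ j ∈ Finset.Ico 1 k, A j z * (hahnDiff q c)^[j] g z) := by
      simp only [Function.iterate_zero, id] at h0
      linear_combination h0
    have h2 : ‖A 0 z‖ * ‖g z‖ ≤
        (2 ^ k * exp (B + 1) * (1 + ∑ j ∈ Finset.Ico 1 k, ‖A j z‖)) * ‖g z‖ := by
      rw [← norm_mul, h1, norm_neg]
      calc _ ≤ ‖(hahnDiff q c)^[k] g z‖ +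
            ∑ j ∈ Finset.Ico 1 k, ‖A j z‖ * ‖(hahnDiff q c)^[j] g z‖ := by
            refine (norm_add_le _ _).trans (add_le_add le_rfl ((norm_sum_le _ _).trans ?_))
            exact Finset.sum_le_sum fun j _ => (norm_mul _ _).le
        _ ≤ 2 ^ k * (exp (B + 1) * ‖g z‖) +
            ∑ j ∈ Finset.Ico 1 k, ‖A j z‖ * (2 ^ k * (exp (B + 1) * ‖g z‖)) := by
            refine add_le_add (hDj k le_rfl) (Finset.sum_le_sum fun j hj => ?_)
            exact mul_le_mul_of_nonneg_left (hDj j (Finset.mem_Ico.1 hj).2.le) (norm_nonneg _)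
        _ = _ := by rw [← Finset.sum_mul]; ring
    have h3 := posLog_le_posLog (norm_nonneg _) (le_of_mul_le_mul_right h2 hzpos)
    have h4 := posLog_mul (x := 2 ^ k * exp (B + 1)) (y := 1 + ∑ j ∈ Finset.Ico 1 k, ‖A j z‖)
    have h5 := posLog_add (x := 1) (y := ∑ j ∈ Finset.Ico 1 k, ‖A j z‖)
    have h6 := posLog_sum (Finset.Ico 1 k) (fun j => ‖A j z‖)
    have h7 : log⁺ (2 ^ k * exp (B + 1)) = k * log 2 + (B + 1) := by
      have e1 : 1 ≤ (2 : ℝ) ^ k := one_le_pow₀ (by norm_num)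
      have e2 : 1 ≤ exp (B + 1) := Real.one_le_exp (by linarith)
      rw [posLog_eq_log (by rw [abs_of_pos (by positivity)]; nlinarith),
        Real.log_mul (by positivity) (exp_pos _).ne', Real.log_exp, Real.log_pow]
    rw [posLog_one] at h5
    linarith
  have hcount : {z | g z = 0}.Countable := by
    have h1 : g ⁻¹' {0}ᶜ ∈ codiscrete ℂ :=
      AnalyticOnNhd.preimage_zero_mem_codiscrete (fun z _ => hg.analyticAt z) hx
    have h2 : IsDiscrete ({z | g z = 0} ∩ Set.univ) :=
      isDiscrete_of_codiscreteWithin h1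
    rw [Set.inter_univ] at h2
    exact (HereditarilyLindelofSpace.isLindelof _).countable_of_isDiscrete h2
  have hintS : CircleIntegrable (fun z => ∑ j ∈ Finset.Ico 1 k, log⁺ ‖A j z‖) 0 r :=
    CircleIntegrable.fun_sum _ hintA
  have hintB : CircleIntegrable
      (fun z => ∑ i ∈ Finset.range n, (log (K * (r + ‖a i‖)) - log ‖z - a i‖)) 0 r :=
    CircleIntegrable.fun_sum _ hintb
  have hmain := circleAverage_mono_of_countable hr0.ne' hcount
    ((hA 0 (by omega)).circleIntegrable_posLog 0 r)
    ((circleIntegrable_const D 0 r).add (hintS.add hintB)) hpoint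
  rw [← (hA 0 (by omega)).characteristic_top_eq] at hmain
  refine hmain.trans ?_
  have e := circleAverage_fun_add (circleIntegrable_const D 0 r) (hintS.add hintB)
  have e' := circleAverage_fun_add hintS hintB
  have hsumA : circleAverage (fun z => ∑ j ∈ Finset.Ico 1 k, log⁺ ‖A j z‖) 0 r =
      ∑ j ∈ Finset.Ico 1 k, ValueDistribution.characteristic (A j) ⊤ r := by
    rw [circleAverage_fun_sum hintA]
    exact Finset.sum_congr rfl fun j hj =>
      ((hA j (Finset.mem_Ico.1 hj).2).characteristic_top_eq r).symm
  have hsumB : circleAverage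
      (fun z => ∑ i ∈ Finset.range n, (log (K * (r + ‖a i‖)) - log ‖z - a i‖)) 0 r ≤
      C * log (2 * K) * log r ^ β := by
    rw [circleAverage_fun_sum hintb]
    refine (Finset.sum_le_card_nsmul _ _ (log (2 * K)) fun i _ =>
      circleAverage_log_sub_log_norm_sub_le (by linarith) hr0 (a i)).trans ?_
    rw [Finset.card_range, nsmul_eq_mul, mul_right_comm]
    exact mul_le_mul_of_nonneg_right hn (Real.log_nonneg (by linarith))
  have hlb : 0 ≤ log r ^ β := Real.rpow_nonneg (Real.log_nonneg hr1) _
  calc _ = D + (∑ j ∈ Finset.Ico 1 k, ValueDistribution.characteristic (A j) ⊤ r +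
        circleAverage
          (fun z => ∑ i ∈ Finset.range n, (log (K * (r + ‖a i‖)) - log ‖z - a i‖)) 0 r) := by
        rw [← hsumA, ← e']
        rw [circleAverage_const D] at e
        exact e
    _ ≤ D + (∑ j ∈ Finset.Ico 1 k, ValueDistribution.characteristic (A j) ⊤ r +
        C * log (2 * K) * log r ^ β) := by gcongr
    _ ≤ _ := by
        have := mul_le_mul_of_nonneg_right (le_max_right D (C * log (2 * K))) hlb
        have := le_max_left D (C * log (2 * K))
        linarith

theorem mainTheorem7 (q c : ℂ) (hq0 : q ≠ 0) (hq1 : ‖q‖ ≠ 1)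
    (k : ℕ) (hk : 1 ≤ k) (A : ℕ → ℂ → ℂ)
    (hA : ∀ j < k, Differentiable ℂ (A j))
    (hA0 : ∀ j, 1 ≤ j → j < k → logOrder (A j) < logOrder (A 0))
    (hA1 : ∀ j, 1 ≤ j → j < k → 1 ≤ logOrder (A j))
    (g : ℂ → ℂ) (hg : Differentiable ℂ g) (hgc : ¬ ∃ a : ℂ, ∀ z, g z = a)
    (heq : ∀ z : ℂ, (q - 1) * z + c ≠ 0 →
      (hahnDiff q c)^[k] g z + ∑ j ∈ Finset.range k, A j z * (hahnDiff q c)^[j] g z = 0) :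
    logOrder (A 0) + 1 ≤ logOrder g := by
  have hg1 := one_le_logOrder hg hgc
  -- For nonpositive order of `A 0`, `one_le_logOrder` suffices; otherwise a positive β fits below
  -- that order.
  rcases le_or_gt (logOrder (A 0)) 0 with hσ | hσ
  · exact (add_le_add_left hσ 1).trans (by simpa using hg1)
  by_contra! hlt
  have hgsub : logOrder g - 1 < logOrder (A 0) := EReal.sub_lt_of_lt_add hlt
  have hsup : max 0 (max (logOrder g - 1) ((Finset.Ico 1 k).sup fun j => logOrder (A j))) <
      logOrder (A 0) := by
    refine max_lt hσ (max_lt hgsub ?_)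
    rw [Finset.sup_lt_iff (lt_of_le_of_lt bot_le hσ)]
    exact fun j hj => hA0 j (Finset.mem_Ico.1 hj).1 (Finset.mem_Ico.1 hj).2
  obtain ⟨β, hβ1, hβ2⟩ := EReal.lt_iff_exists_real_btwn.1 hsup
  -- The gap between β and β' absorbs the constants: (log r)^(β'-β) eventually exceeds them.
  obtain ⟨β', hβ3, hβ4⟩ := EReal.lt_iff_exists_real_btwn.1 hβ2
  rw [EReal.coe_lt_coe_iff] at hβ3
  obtain ⟨h0β, hβ1⟩ := max_lt_iff.1 hβ1
  obtain ⟨hgβ, hAβ⟩ := max_lt_iff.1 hβ1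
  have hβ0 : 0 < β := by exact_mod_cast h0β
  rw [Finset.sup_lt_iff (EReal.bot_lt_coe β)] at hAβ
  have hgβ' : logOrder g < ((β + 1 : ℝ) : EReal) := by
    rw [EReal.coe_add, EReal.coe_one]
    exact (EReal.sub_lt_iff (Or.inl (EReal.coe_ne_bot 1)) (Or.inl (EReal.coe_ne_top 1))).1 hgβ
  obtain ⟨x, hx⟩ : ∃ x, g x ≠ 0 := by
    by_contra! hcon
    exact hgc ⟨0, hcon⟩
  obtain ⟨C, hC⟩ := eventually_characteristic_coeff_le hq0 (fun h => hq1 (by simp [h])) hk hA hg hx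
    heq hβ0.le (eventually_characteristic_le_of_logOrder_lt hgβ')
  have hTA : ∀ᶠ r in atTop, ∀ j ∈ Finset.Ico 1 k,
      ValueDistribution.characteristic (A j) ⊤ r ≤ log r ^ β :=
    (Filter.eventually_all_finset _).2 fun j hj =>
      eventually_characteristic_le_of_logOrder_lt (hAβ j hj)
  have hlog : ∀ᶠ r : ℝ in atTop, (|C| + k + |C|) ≤ log r ^ (β' - β) :=
    ((tendsto_rpow_atTop (sub_pos.2 hβ3)).comp Real.tendsto_log_atTop).eventually_ge_atTop _
  refine absurd hβ4 (not_lt.2 (logOrder_le_of_eventually_characteristic_le (by linarith) ?_ ?_))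
  · filter_upwards [hC, hTA, hlog, eventually_ge_atTop (exp 1)] with r h1 h2 h3 he
    have hl : 1 ≤ log r := by rwa [Real.le_log_iff_exp_le ((exp_pos 1).trans_le he)]
    have hb1 : 1 ≤ log r ^ β := Real.one_le_rpow hl hβ0.le
    have h4 := Finset.sum_le_card_nsmul _ _ _ h2
    rw [Nat.card_Ico, nsmul_eq_mul] at h4
    have h5 : ((k - 1 : ℕ) : ℝ) * log r ^ β ≤ k * log r ^ β := by
      gcongr
      exact Nat.sub_le k 1
    have h6 : C * log r ^ β ≤ |C| * log r ^ β := by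
      gcongr
      exact le_abs_self C
    have h7 : C ≤ |C| * log r ^ β :=
      (le_abs_self C).trans (le_mul_of_one_le_right (abs_nonneg C) hb1)
    calc _ ≤ (|C| + k + |C|) * log r ^ β := by linarith
      _ ≤ log r ^ (β' - β) * log r ^ β := by gcongr
      _ = _ := by rw [← Real.rpow_add (by linarith), sub_add_cancel]
  · filter_upwards [eventually_ge_atTop 1] with r hr
    exact ValueDistribution.characteristic_nonneg hr
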